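/- Let $\Omega$ be a Stonian space (a compact Hausdorff extremally disconnected space), and let $C(\Omega)$ be the $C^*$-algebra of continuous functions $\Omega\to\mathbb C$. Let $X$ be a unital Banach $C(\Omega)$-module (so $\|f\cdot x\|\le\|f\|\,\|x\|$) that is $C(\Omega)$-convex, i.e. $\|f\cdot x+g\cdot y\|\le\max(\|x\|,\|y\|)$ for all $x,y\in X$ and all $f,g\in C(\Omega)_+$ with $f+g=1$. **Regularization.** For a normed $C(\Omega)$-module $Y$ let $Y^s$ be the normed $C(\Omega)$-module of bounded $C(\Omega)$-module maps $Y\to C(\Omega)$ (operator norm, action $(f\cdot T)(y)=fT(y)$), and let $\kappa_Y:Y\to Y^{ss}$, $\kappa_Y(y)(T)=T(y)$. The module $Y$ is *regular* if $\kappa_Y$ is an isometry. The regularization $X_{\rm reg}$ is the closure of $\kappa_X(X)$ in $X^{ss}$ with the induced norm. **Essential seminorm.** For $x\in X$ and $\omega\in\Omega$ let $|x|(\omega)=\|x(\omega)\|$ be the norm of the class $x(\omega)$ of $x$ in the Banach space $X/\overline{I_\omega\cdot X}$, where $I_\omega=\{f\in C(\Omega): f(\omega)=0\}$ and $I_\omega\cdot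 X$ is the linear span of the products. Put $$\|x\|_e=\inf\Big\{\sup_{\omega\in\Delta}|x|(\omega)\;:\;\Delta\subseteq\Omega\text{ open and dense}\Big\}.$$ This is a seminorm on $X$. Let $X_{\rm ess}$ be the completion of $(X/N,\|\cdot\|_e)$, $N=\{x:\|x\|_e=0\}$, with the induced $C(\Omega)$-module structure. **Theorem.** $X_{\rm reg}=X_{\rm ess}$: there is an isometric $C(\Omega)$-module isomorphism of $X_{\rm reg}$ onto $X_{\rm ess}$ that sends $\kappa_X(x)$ to the image of $x$ in $X_{\rm ess}$, for every $x\in X$. Consequently, if $X$ comes from an (F)-Banach bundle, then $X$ is regular. Here an *(H)-Banach bundle* over $\Omega$ is a family of complex Banach spaces $(E_\omega)_{\omega\in\Omega}$ with a topology on $E=\bigsqcup_\omega E_\omega$ such that the projection $p:E\to\Omega$ is continuous and open, addition $E\times_\Omega E\to E$ and scalar multiplication $\mathbb C\times E\to E$ are continuous, $e\mapsto\|e\|$ is upper semicontinuous, and for each $\omega$ the sets $\{e: p(e)\in U,\ \|e\|<\varepsilon\}$ ($U$ a neighbourhood of $\omega$, $\varepsilon>0$) form a neighbourhood base at $0_\omega$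 in $E$. It is an *(F)-Banach bundle* if moreover $e\mapsto\|e\|$ is continuous. $X$ *comes from* the bundle if $X$ is isometrically isomorphic, as a $C(\Omega)$-module, to the module $\Gamma(E)$ of continuous sections with pointwise operations and the supremum norm. -/

import Mathlib

open Topology Set Filter

universe u v w

noncomputable section

section Modules

variable (Ω : Type u) [TopologicalSpace Ω] [CompactSpace Ω]
variable (X : Type v) [NormedAddCommGroup X] [Module C(Ω, ℂ) X]

open scoped ComplexOrder in
/-- A Banach module `X` over `C(Ω)` is `C(Ω)`-convex if its closed balls are stable under
convex combinations `f x + g y` with coefficients `f, g ∈ C(Ω)₊`, `f + g = 1`. -/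
def IsCConvex : Prop :=
  ∀ f g : C(Ω, ℂ), (∀ ω, 0 ≤ f ω) → (∀ ω, 0 ≤ g ω) → f + g = 1 →
    ∀ x y : X, ‖f • x + g • y‖ ≤ max ‖x‖ ‖y‖

/-! ### The regular dual, the bidual map and the regularization -/

section RegularDual

variable [NormedSpace ℂ X]

/-- The bounded `C(Ω)`-module maps `X → C(Ω)`, as a submodule of the bounded linear maps for the
action `(f • T) x = f * T x`. -/
def moduleMaps : Submodule C(Ω, ℂ) (X →L[ℂ] C(Ω, ℂ)) where
  carrier := {T | ∀ (f : C(Ω, ℂ)) (x : X), T (f • x) = f * T x}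
  add_mem' := by
    intro S T hS hT f x
    simp only [mem_ofPred_eq] at hS hT
    simp [hS f x, hT f x, mul_add]
  zero_mem' := by intro f x; simp
  smul_mem' := by
    intro g T hT f x
    simp only [mem_ofPred_eq] at hT
    simp [hT f x, mul_left_comm]

/-- The regular dual `X^s` of a `C(Ω)`-module: the bounded `C(Ω)`-module maps `X → C(Ω)`, with the
operator norm and the action `(f • T) x = f * T x`. -/
def RegDual : Type (max u v) := moduleMaps Ω X

namespace RegDual

instance : NormedAddCommGroup (RegDual Ω X) := inferInstanceAs (NormedAddCommGroup (moduleMaps Ω X))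

instance : NormedSpace ℂ (RegDual Ω X) := inferInstanceAs (NormedSpace ℂ (moduleMaps Ω X))

instance : Module C(Ω, ℂ) (RegDual Ω X) := inferInstanceAs (Module C(Ω, ℂ) (moduleMaps Ω X))

instance : IsScalarTower ℂ C(Ω, ℂ) (RegDual Ω X) :=
  inferInstanceAs (IsScalarTower ℂ C(Ω, ℂ) (moduleMaps Ω X))

instance : IsBoundedSMul C(Ω, ℂ) (RegDual Ω X) :=
  IsBoundedSMul.of_norm_smul_le fun (f : C(Ω, ℂ)) (T : RegDual Ω X) => by
    refine ContinuousLinearMap.opNorm_le_bound (f • T.1)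
      (mul_nonneg (norm_nonneg f) (norm_nonneg T)) fun x => ?_
    calc ‖f * T.1 x‖ ≤ ‖f‖ * ‖T.1 x‖ := norm_mul_le _ _
      _ ≤ ‖f‖ * (‖T.1‖ * ‖x‖) := mul_le_mul_of_nonneg_left (T.1.le_opNorm x) (norm_nonneg f)
      _ = ‖f‖ * ‖T.1‖ * ‖x‖ := (mul_assoc _ _ _).symm

end RegDual

/-- The canonical map `κ_X : X → X^ss`, `κ_X(x)(φ) = φ(x)`. -/
def kappa : X →ₗ[C(Ω, ℂ)] RegDual Ω (RegDual Ω X) where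
  toFun x :=
    ⟨LinearMap.mkContinuous
      { toFun := fun T : RegDual Ω X => T.1 x
        map_add' := fun _ _ => rfl
        map_smul' := fun _ _ => rfl } ‖x‖
      (fun T => by
        have h := T.1.le_opNorm x
        rw [mul_comm] at h
        exact h),
      fun _ _ => rfl⟩
  map_add' x y := by
    apply Subtype.ext; ext T : 1
    exact T.1.map_add x y
  map_smul' f x := by
    apply Subtype.ext; ext T : 1
    exact T.2 f x

theorem kappa_apply (x : X) (T : RegDual Ω X) : (kappa Ω X x).1 T = T.1 x := rfl

/-- `X` is regular if `κ_X` is an isometry. -/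
def IsRegularModule : Prop := Isometry (kappa Ω X)

/-- The regularization `X_reg`: the closure of `κ_X(X)` in `X^ss`, with the induced norm. -/
def regularization : Submodule C(Ω, ℂ) (RegDual Ω (RegDual Ω X)) :=
  (LinearMap.range (kappa Ω X)).topologicalClosure

/-- The canonical map from `X` to its regularization. -/
def toRegularization (x : X) : regularization Ω X :=
  ⟨kappa Ω X x, Submodule.le_topologicalClosure _ (LinearMap.mem_range_self _ x)⟩

end RegularDual

/-! ### Fibres, the essential seminorm and its completion -/

variable [IsBoundedSMul C(Ω, ℂ) X]

/-- The closed submodule `closure (I_ω · X)`, where `I_ω = {f | f ω = 0}`. -/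
def fibreKer (ω : Ω) : Submodule C(Ω, ℂ) X :=
  (Submodule.span C(Ω, ℂ) {z : X | ∃ (f : C(Ω, ℂ)) (y : X), f ω = 0 ∧ z = f • y}).topologicalClosure

/-- The function `|x| : Ω → ℝ`, `|x|(ω) = ‖x(ω)‖`, where `x(ω)` is the value of `x` in the fibre
`X / closure (I_ω · X)` at `ω` of the (H)-Banach bundle of the module `X`, with the quotient
norm. -/
def fibreNorm (x : X) (ω : Ω) : ℝ := ‖(Submodule.Quotient.mk x : X ⧸ fibreKer Ω X ω)‖

variable {Ω} in
/-- `‖h‖_e`: the infimum over all open dense `Δ` of `sup_{ω ∈ Δ} h ω` (for bounded `h ≥ 0`). -/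
def essSupNorm (h : Ω → ℝ) : ℝ :=
  ⨅ Δ : {Δ : Set Ω // IsOpen Δ ∧ Dense Δ}, ⨆ ω : Δ.1, h ω

/-- The essential seminorm `‖x‖_e = ‖ |x| ‖_e`. -/
def essNorm (x : X) : ℝ := essSupNorm (fibreNorm Ω X x)

variable {X}

theorem fibreNorm_nonneg (x : X) (ω : Ω) : 0 ≤ fibreNorm Ω X x ω := norm_nonneg _

theorem fibreNorm_le (x : X) (ω : Ω) : fibreNorm Ω X x ω ≤ ‖x‖ :=
  Submodule.Quotient.norm_mk_le _ x

theorem fibreNorm_add_le (x y : X) (ω : Ω) :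
    fibreNorm Ω X (x + y) ω ≤ fibreNorm Ω X x ω + fibreNorm Ω X y ω :=
  norm_add_le (Submodule.Quotient.mk x : X ⧸ fibreKer Ω X ω) (Submodule.Quotient.mk y)

theorem fibreNorm_smul_le (f : C(Ω, ℂ)) (x : X) (ω : Ω) :
    fibreNorm Ω X (f • x) ω ≤ ‖f‖ * fibreNorm Ω X x ω :=
  norm_smul_le f (Submodule.Quotient.mk x : X ⧸ fibreKer Ω X ω)

theorem bddAbove_fibreNorm (x : X) (Δ : Set Ω) :
    BddAbove (range fun ω : Δ => fibreNorm Ω X x ω) :=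
  ⟨‖x‖, by rintro _ ⟨ω, rfl⟩; exact fibreNorm_le Ω x ω⟩

theorem iSup_fibreNorm_nonneg (x : X) (Δ : Set Ω) : 0 ≤ ⨆ ω : Δ, fibreNorm Ω X x ω :=
  Real.iSup_nonneg fun ω => fibreNorm_nonneg Ω x ω

theorem bddBelow_iSup_fibreNorm (x : X) :
    BddBelow (range fun Δ : {Δ : Set Ω // IsOpen Δ ∧ Dense Δ} =>
      ⨆ ω : Δ.1, fibreNorm Ω X x ω) :=
  ⟨0, by rintro _ ⟨Δ, rfl⟩; exact iSup_fibreNorm_nonneg Ω x Δ.1⟩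

instance : Nonempty {Δ : Set Ω // IsOpen Δ ∧ Dense Δ} := ⟨⟨univ, isOpen_univ, dense_univ⟩⟩

theorem essNorm_nonneg (x : X) : 0 ≤ essNorm Ω X x :=
  Real.iInf_nonneg fun Δ => iSup_fibreNorm_nonneg Ω x Δ.1

theorem essNorm_smul_le (f : C(Ω, ℂ)) (x : X) :
    essNorm Ω X (f • x) ≤ ‖f‖ * essNorm Ω X x := by
  unfold essNorm essSupNorm
  rw [Real.mul_iInf_of_nonneg (norm_nonneg f)]
  refine ciInf_mono (bddBelow_iSup_fibreNorm Ω _) fun Δ => ?_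
  refine Real.iSup_le (fun ω => ?_)
    (mul_nonneg (norm_nonneg _) (iSup_fibreNorm_nonneg Ω x Δ.1))
  exact (fibreNorm_smul_le Ω f x ω).trans
    (mul_le_mul_of_nonneg_left (le_ciSup (bddAbove_fibreNorm Ω x Δ.1) ω) (norm_nonneg f))

theorem essNorm_add_le (x y : X) :
    essNorm Ω X (x + y) ≤ essNorm Ω X x + essNorm Ω X y := by
  refine le_ciInf_add_ciInf fun Δ₁ Δ₂ => ?_
  have hΔ : IsOpen (Δ₁.1 ∩ Δ₂.1) ∧ Dense (Δ₁.1 ∩ Δ₂.1) :=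
    ⟨Δ₁.2.1.inter Δ₂.2.1, Δ₁.2.2.inter_of_isOpen_left Δ₂.2.2 Δ₁.2.1⟩
  refine (ciInf_le (bddBelow_iSup_fibreNorm Ω (x + y)) ⟨_, hΔ⟩).trans ?_
  refine Real.iSup_le (fun ω => ?_)
    (add_nonneg (iSup_fibreNorm_nonneg Ω x _) (iSup_fibreNorm_nonneg Ω y _))
  exact (fibreNorm_add_le Ω x y ω).trans (add_le_add
    (le_ciSup (bddAbove_fibreNorm Ω x Δ₁.1) ⟨ω.1, ω.2.1⟩)
    (le_ciSup (bddAbove_fibreNorm Ω y Δ₂.1) ⟨ω.1, ω.2.2⟩))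

theorem essNorm_zero : essNorm Ω X (0 : X) = 0 := by
  refine le_antisymm ?_ (essNorm_nonneg Ω 0)
  have h := essNorm_smul_le Ω (0 : C(Ω, ℂ)) (0 : X)
  simpa using h

theorem essNorm_neg (x : X) : essNorm Ω X (-x) = essNorm Ω X x := by
  have h : ∀ ω, fibreNorm Ω X (-x) ω = fibreNorm Ω X x ω := fun ω =>
    norm_neg (Submodule.Quotient.mk x : X ⧸ fibreKer Ω X ω)
  unfold essNorm
  rw [funext h]

variable (X)

/-- The module `X`, to be equipped with the seminorm `‖·‖_e` in place of its norm. -/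
def EssPre (_ : Type u) (X : Type v) : Type v := X

namespace EssPre

instance : AddCommGroup (EssPre Ω X) := inferInstanceAs (AddCommGroup X)

instance : Module C(Ω, ℂ) (EssPre Ω X) := inferInstanceAs (Module C(Ω, ℂ) X)

instance : SeminormedAddCommGroup (EssPre Ω X) :=
  AddGroupSeminorm.toSeminormedAddCommGroup
    { toFun := fun x : EssPre Ω X => essNorm Ω X x
      map_zero' := essNorm_zero (X := X) Ω
      add_le' := essNorm_add_le (X := X) Ω
      neg' := essNorm_neg (X := X) Ω }

instance : IsBoundedSMul C(Ω, ℂ) (EssPre Ω X) :=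
  IsBoundedSMul.of_norm_smul_le fun (f : C(Ω, ℂ)) (x : EssPre Ω X) =>
    essNorm_smul_le (X := X) Ω f (show X from x)

end EssPre

/-- `X_ess`: the (Hausdorff) completion of `X` for the seminorm `‖·‖_e`, that is, the completion of
the normed space `(X / N, ‖·‖_e)` with `N = {x | ‖x‖_e = 0}`. -/
abbrev EssCompletion : Type v := UniformSpace.Completion (EssPre Ω X)

variable {X} in
/-- The canonical map from `X` to `X_ess`. -/
def toEssCompletion (x : X) : EssCompletion Ω X := ((show EssPre Ω X from x : EssPre Ω X) :)

theorem norm_toEssCompletion (x : X) : ‖toEssCompletion Ω x‖ = essNorm Ω X x :=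
  UniformSpace.Completion.norm_coe (E := EssPre Ω X) x

end Modules

/-! ### Banach bundles -/

/-- An (H)-Banach bundle over `Ω`: Banach spaces `Fibre ω`, and a topology on the total space such
that the projection is continuous and open, addition and multiplication by scalars are continuous,
the norm is upper semicontinuous, and the sets `{e | p e ∈ U, ‖e‖ < ε}` (`U` a neighbourhood
of `ω`, `ε > 0`) form a neighbourhood base at the zero of the fibre at `ω`. -/
structure BanachBundle (Ω : Type u) [TopologicalSpace Ω] where
  Fibre : Ω → Type w
  [normedAddCommGroup : ∀ ω, NormedAddCommGroup (Fibre ω)]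
  [normedSpace : ∀ ω, NormedSpace ℂ (Fibre ω)]
  [complete : ∀ ω, CompleteSpace (Fibre ω)]
  [topTotal : TopologicalSpace (Bundle.TotalSpace Unit Fibre)]
  continuous_proj : Continuous (Bundle.TotalSpace.proj : Bundle.TotalSpace Unit Fibre → Ω)
  isOpenMap_proj : IsOpenMap (Bundle.TotalSpace.proj : Bundle.TotalSpace Unit Fibre → Ω)
  /-- Addition is continuous on the fibre product `{(a, b) | p a = p b}`, with the topology induced
  by that of the product of two copies of the total space. -/
  continuous_add :
    Continuous[TopologicalSpace.induced
        (fun q : (ω : Ω) × (Fibre ω × Fibre ω) =>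
          ((⟨q.1, q.2.1⟩, ⟨q.1, q.2.2⟩) :
            Bundle.TotalSpace Unit Fibre × Bundle.TotalSpace Unit Fibre)) inferInstance, topTotal]
      (fun q : (ω : Ω) × (Fibre ω × Fibre ω) => ⟨q.1, q.2.1 + q.2.2⟩)
  continuous_smul :
    Continuous fun q : ℂ × Bundle.TotalSpace Unit Fibre =>
      (⟨q.2.1, q.1 • q.2.2⟩ : Bundle.TotalSpace Unit Fibre)
  upperSemicontinuous_norm :
    UpperSemicontinuous fun e : Bundle.TotalSpace Unit Fibre => ‖e.2‖
  nhds_zero_hasBasis : ∀ ω : Ω,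
    (𝓝 (⟨ω, 0⟩ : Bundle.TotalSpace Unit Fibre)).HasBasis
      (fun i : Set Ω × ℝ => i.1 ∈ 𝓝 ω ∧ 0 < i.2)
      (fun i => {e | e.1 ∈ i.1 ∧ ‖e.2‖ < i.2})

namespace BanachBundle

attribute [instance] normedAddCommGroup normedSpace complete topTotal

variable {Ω : Type u} [TopologicalSpace Ω] (B : BanachBundle.{u, w} Ω)

/-- The total space of the bundle. -/
abbrev Total : Type (max u w) := Bundle.TotalSpace Unit B.Fibre

/-- An (F)-Banach bundle is one whose norm is continuous on the total space. -/
def IsFell : Prop := Continuous fun e : B.Total => ‖e.2‖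

theorem continuous_add_section {s t : ∀ ω, B.Fibre ω}
    (hs : Continuous fun ω => (⟨ω, s ω⟩ : B.Total))
    (ht : Continuous fun ω => (⟨ω, t ω⟩ : B.Total)) :
    Continuous fun ω => (⟨ω, s ω + t ω⟩ : B.Total) := by
  let _ : TopologicalSpace ((ω : Ω) × (B.Fibre ω × B.Fibre ω)) :=
    TopologicalSpace.induced (fun q => ((⟨q.1, q.2.1⟩, ⟨q.1, q.2.2⟩) : B.Total × B.Total))
      inferInstance
  have h : Continuous fun ω => (⟨ω, (s ω, t ω)⟩ : (ω : Ω) × (B.Fibre ω × B.Fibre ω)) :=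
    continuous_induced_rng.2 (hs.prodMk ht)
  exact B.continuous_add.comp h

theorem continuous_smul_section {s : ∀ ω, B.Fibre ω} {f : Ω → ℂ} (hf : Continuous f)
    (hs : Continuous fun ω => (⟨ω, s ω⟩ : B.Total)) :
    Continuous fun ω => (⟨ω, f ω • s ω⟩ : B.Total) :=
  B.continuous_smul.comp (hf.prodMk hs)

/-- The space `Γ(B)` of continuous sections. -/
def sections : AddSubgroup (∀ ω, B.Fibre ω) where
  carrier := {s | Continuous fun ω => (⟨ω, s ω⟩ : B.Total)}
  add_mem' hs ht := B.continuous_add_section hs ht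
  zero_mem' := by
    refine continuous_iff_continuousAt.2 fun ω => ?_
    refine (B.nhds_zero_hasBasis ω).tendsto_right_iff.2 fun i hi => ?_
    filter_upwards [hi.1] with ω' h'
    exact ⟨h', by simpa using hi.2⟩
  neg_mem' {s} hs := by
    have h := B.continuous_smul_section (f := fun _ => (-1 : ℂ)) continuous_const hs
    simpa using h

variable {B}

/-- Sections are a `C(Ω)`-module under the pointwise action `(f • s) ω = f ω • s ω`. -/
instance : Module C(Ω, ℂ) B.sections where
  smul f s := ⟨fun ω => f ω • s.1 ω, B.continuous_smul_section f.continuous s.2⟩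
  one_smul s := Subtype.ext (funext fun ω => one_smul ℂ (s.1 ω))
  mul_smul f g s := Subtype.ext (funext fun ω => mul_smul (f ω) (g ω) (s.1 ω))
  smul_zero f := Subtype.ext (funext fun ω => smul_zero (f ω))
  smul_add f s t := Subtype.ext (funext fun ω => smul_add (f ω) (s.1 ω) (t.1 ω))
  add_smul f g s := Subtype.ext (funext fun ω => add_smul (f ω) (g ω) (s.1 ω))
  zero_smul s := Subtype.ext (funext fun ω => zero_smul ℂ (s.1 ω))

theorem smul_section_apply (f : C(Ω, ℂ)) (s : B.sections) (ω : Ω) :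
    (f • s).1 ω = f ω • s.1 ω := rfl

theorem bddAbove_norm_section [CompactSpace Ω] (s : B.sections) :
    BddAbove (range fun ω => ‖s.1 ω‖) := by
  have h : UpperSemicontinuous fun ω => ‖s.1 ω‖ :=
    B.upperSemicontinuous_norm.comp s.2
  have h2 := (h.upperSemicontinuousOn univ).bddAbove_of_isCompact isCompact_univ
  rwa [image_univ] at h2

/-- Sections carry the norm `‖s‖ = sup_ω ‖s ω‖`. -/
instance [CompactSpace Ω] : NormedAddCommGroup B.sections :=
  AddGroupNorm.toNormedAddCommGroup
    { toFun := fun s => ⨆ ω, ‖s.1 ω‖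
      map_zero' := by simp
      add_le' := fun s t => by
        refine Real.iSup_le (fun ω => ?_) (add_nonneg
          (Real.iSup_nonneg fun _ => norm_nonneg _) (Real.iSup_nonneg fun _ => norm_nonneg _))
        exact (norm_add_le _ _).trans (add_le_add
          (le_ciSup (bddAbove_norm_section s) ω) (le_ciSup (bddAbove_norm_section t) ω))
      neg' := fun s => by simp
      eq_zero_of_map_eq_zero' := fun s hs => by
        refine Subtype.ext (funext fun ω => norm_le_zero_iff.1 ?_)
        exact (le_ciSup (bddAbove_norm_section s) ω).trans hs.le }

theorem norm_section_def [CompactSpace Ω] (s : B.sections) : ‖s‖ = ⨆ ω, ‖s.1 ω‖ := rfl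

end BanachBundle

end

/-!
Both sides are completions of `X` for seminorms, so everything reduces to `‖κ x‖ = ‖x‖_e`.

*Upper bound.* If `T : X → C(Ω)` is a module map with `‖T‖ ≤ 1`, then `y ↦ T y ω` kills `I_ω · X`,
hence `|T x| ≤ |x|` pointwise (`norm_apply_le_fibreNorm`). As `T x` is continuous, the supremum of
`|T x|` over any dense set is `‖T x‖`, so `‖T x‖ ≤ ‖x‖_e` (`norm_apply_le_essNorm`).

*Lower bound.* Choose for each `η` a functional `φ η` with `‖φ η‖ ≤ 1` on the fibre at `η` that
norms the class of `x`. The function `η ↦ φ η y` need not be continuous; continuous limits replace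
it. The limit map from ultrafilters on `Ω` to `Ω` is a continuous surjection of compact Hausdorff
spaces, and `Ω`, being extremally disconnected, is projective, so there is a continuous choice of
ultrafilters `s ω → ω` (`exists_continuous_ultrafilter_le_nhds`). Taking the limit of `φ · y` along
`s ω` gives a contractive module map `T` into `C(Ω)` (`exists_regDual_tendsto`). If `|x| ≥ c` on a
nonempty open set, then `|T x ω| ≥ c` for `ω` in this set, so `‖κ x‖ ≥ c`. As `|x|` is upper
semicontinuous (`upperSemicontinuous_fibreNorm`), the set `{|x| < c}` is therefore open and dense
for every `c > ‖κ x‖`, which says `‖x‖_e ≤ ‖κ x‖` (`norm_kappa_eq_essNorm`).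

For a bundle with continuous norm, evaluation at `ω` gives `‖s ω‖ ≤ |s|(ω)`, and the supremum of
the continuous function `‖s ω‖` over a dense set is `‖s‖`, so `‖s‖_e = ‖s‖` and `κ` is isometric.
-/

section FibreNorm

variable {Ω : Type u} [TopologicalSpace Ω] [CompactSpace Ω]
variable {X : Type v} [NormedAddCommGroup X] [Module C(Ω, ℂ) X] [IsBoundedSMul C(Ω, ℂ) X]

/-! ### The norms of the fibres -/

theorem smul_mem_fibreKer {f : C(Ω, ℂ)} {ω : Ω} (hf : f ω = 0) (y : X) :
    f • y ∈ fibreKer Ω X ω :=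
  Submodule.le_topologicalClosure _ (Submodule.subset_span ⟨f, y, hf, rfl⟩)

theorem fibreNorm_eq_of_sub_mem {x y : X} {ω : Ω} (h : x - y ∈ fibreKer Ω X ω) :
    fibreNorm Ω X x ω = fibreNorm Ω X y ω :=
  congrArg norm ((Submodule.Quotient.eq _).2 h)

theorem fibreNorm_smul_le_norm_apply_mul (f : C(Ω, ℂ)) (y : X) (ω : Ω) :
    fibreNorm Ω X (f • y) ω ≤ ‖f ω‖ * ‖y‖ := by
  have h : f • y - ContinuousMap.const Ω (f ω) • y ∈ fibreKer Ω X ω := by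
    rw [← sub_smul]
    exact smul_mem_fibreKer (by simp) y
  rw [fibreNorm_eq_of_sub_mem h]
  refine (fibreNorm_le Ω _ ω).trans ((norm_smul_le _ _).trans ?_)
  refine mul_le_mul_of_nonneg_right ?_ (norm_nonneg y)
  exact (ContinuousMap.norm_le _ (norm_nonneg _)).2 fun _ => le_rfl

/-- An element whose class in the fibre at `ω` vanishes has small classes in the fibres
near `ω`. -/
theorem tendsto_fibreNorm_of_mem_fibreKer {z : X} {ω : Ω} (hz : z ∈ fibreKer Ω X ω) :
    Tendsto (fibreNorm Ω X z) (𝓝 ω) (𝓝 0) := by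
  have key : ∀ z ∈ Submodule.span C(Ω, ℂ)
      {z : X | ∃ (f : C(Ω, ℂ)) (y : X), f ω = 0 ∧ z = f • y},
      Tendsto (fibreNorm Ω X z) (𝓝 ω) (𝓝 0) := by
    intro z hz
    induction hz using Submodule.span_induction with
    | mem z hz =>
      obtain ⟨f, y, hf, rfl⟩ := hz
      refine squeeze_zero (fibreNorm_nonneg Ω _) (fibreNorm_smul_le_norm_apply_mul f y) ?_
      have h : Continuous fun η => ‖f η‖ * ‖y‖ := by fun_prop
      simpa [hf] using h.tendsto ω
    | zero =>
      exact squeeze_zero (fibreNorm_nonneg Ω _) (fun η => fibreNorm_le Ω _ η) (by simp)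
    | add x y _ _ hx hy =>
      exact squeeze_zero (fibreNorm_nonneg Ω _) (fibreNorm_add_le Ω x y)
        (by simpa using hx.add hy)
    | smul f x _ hx =>
      exact squeeze_zero (fibreNorm_nonneg Ω _) (fibreNorm_smul_le Ω f x)
        (by simpa using hx.const_mul ‖f‖)
  refine (tendsto_order.2 ⟨fun a ha => ?_, fun a ha => ?_⟩)
  · exact Eventually.of_forall fun η => ha.trans_le (fibreNorm_nonneg Ω z η)
  · obtain ⟨z', hz', hd⟩ := Metric.mem_closure_iff.1 hz (a / 2) (half_pos ha)
    filter_upwards [(key z' hz').eventually_lt_const (half_pos ha)] with η hη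
    have h := fibreNorm_add_le Ω (z - z') z' η
    rw [sub_add_cancel] at h
    rw [dist_eq_norm] at hd
    linarith [fibreNorm_le Ω (z - z') η]

theorem upperSemicontinuous_fibreNorm (x : X) : UpperSemicontinuous (fibreNorm Ω X x) := by
  intro ω c hc
  obtain ⟨m, hm, hmc⟩ := Submodule.Quotient.norm_mk_lt
    (Submodule.Quotient.mk x : X ⧸ fibreKer Ω X ω) (sub_pos.2 hc)
  have hmc : ‖m‖ < c := by
    have h : ‖(Submodule.Quotient.mk x : X ⧸ fibreKer Ω X ω)‖ = fibreNorm Ω X x ω := rfl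
    linarith
  have hk : x - m ∈ fibreKer Ω X ω := (Submodule.Quotient.eq _).1 hm.symm
  filter_upwards [(tendsto_fibreNorm_of_mem_fibreKer hk).eventually_lt_const
    (sub_pos.2 hmc)] with η hη
  have h := fibreNorm_add_le Ω (x - m) m η
  rw [sub_add_cancel] at h
  linarith [fibreNorm_le Ω m η]

/-- A contraction of `X` into a normed space on which `C(Ω)` acts through evaluation at `ω` factors
as a contraction through the fibre at `ω`. -/
theorem norm_apply_le_fibreNorm {E : Type*} [NormedAddCommGroup E] [NormedSpace ℂ E] {ω : Ω}
    (φ : X →+ E) (hφ : ∀ x, ‖φ x‖ ≤ ‖x‖) (hsmul : ∀ (f : C(Ω, ℂ)) x, φ (f • x) = f ω • φ x)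
    (x : X) : ‖φ x‖ ≤ fibreNorm Ω X x ω := by
  let K : Submodule C(Ω, ℂ) X :=
    { carrier := {y | φ y = 0}
      add_mem' := fun {a b} ha hb => by
        change φ (a + b) = 0
        rw [map_add, show φ a = 0 from ha, show φ b = 0 from hb, add_zero]
      zero_mem' := map_zero φ
      smul_mem' := fun f y hy => by
        change φ (f • y) = 0
        rw [hsmul, show φ y = 0 from hy, smul_zero] }
  have hcont : Continuous φ :=
    AddMonoidHomClass.continuous_of_bound φ 1 fun y => by simpa using hφ y
  have hK : fibreKer Ω X ω ≤ K := by
    refine Submodule.topologicalClosure_minimal _ (Submodule.span_le.2 ?_)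
      (isClosed_eq hcont continuous_const)
    rintro _ ⟨f, y, hf, rfl⟩
    change φ (f • y) = 0
    rw [hsmul, hf, zero_smul]
  refine le_of_forall_pos_le_add fun ε hε => ?_
  obtain ⟨m, hm, hmε⟩ := Submodule.Quotient.norm_mk_lt
    (Submodule.Quotient.mk x : X ⧸ fibreKer Ω X ω) hε
  have h0 : φ (m - x) = 0 := hK ((Submodule.Quotient.eq _).1 hm)
  rw [map_sub, sub_eq_zero] at h0
  rw [← h0]
  exact (hφ m).trans hmε.le

/-- The essential seminorm dominates each continuous minorant of `|x|`. -/
theorem le_essNorm_of_continuous {x : X} {h : Ω → ℝ} (hc : Continuous h)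
    (hle : ∀ ω, h ω ≤ fibreNorm Ω X x ω) (ω : Ω) : h ω ≤ essNorm Ω X x := by
  refine le_ciInf fun Δ => ?_
  have hsub : Δ.1 ⊆ {η | h η ≤ ⨆ ω : Δ.1, fibreNorm Ω X x ω} := fun η hη =>
    (hle η).trans (le_ciSup (bddAbove_fibreNorm Ω x Δ.1) ⟨η, hη⟩)
  exact (isClosed_le hc continuous_const).closure_subset_iff.2 hsub (Δ.2.2 ω)

theorem essNorm_le_of_dense {x : X} {c : ℝ} (hc : 0 ≤ c)
    (hd : Dense {ω | fibreNorm Ω X x ω < c}) : essNorm Ω X x ≤ c :=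
  (ciInf_le (bddBelow_iSup_fibreNorm Ω x)
    ⟨_, (upperSemicontinuous_fibreNorm x).isOpen_preimage c, hd⟩).trans
    (Real.iSup_le (fun ω => le_of_lt ω.2) hc)

theorem essNorm_le_norm (x : X) : essNorm Ω X x ≤ ‖x‖ :=
  (ciInf_le (bddBelow_iSup_fibreNorm Ω x) ⟨univ, isOpen_univ, dense_univ⟩).trans
    (Real.iSup_le (fun ω => fibreNorm_le Ω x ω) (norm_nonneg x))

end FibreNorm

/-! ### Module maps into `C(Ω)` -/

/-- On an extremally disconnected compact Hausdorff space one can choose, continuously in `ω`, an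
ultrafilter converging to `ω`. -/
theorem exists_continuous_ultrafilter_le_nhds (Ω : Type u) [TopologicalSpace Ω] [CompactSpace Ω]
    [T2Space Ω] [ExtremallyDisconnected Ω] :
    ∃ s : Ω → Ultrafilter Ω, Continuous s ∧ ∀ ω, (s ω : Filter Ω) ≤ 𝓝 ω := by
  have hg : Continuous (Ultrafilter.extend (id : Ω → Ω)) := continuous_ultrafilter_extend _
  have hsurj : Function.Surjective (Ultrafilter.extend (id : Ω → Ω)) := fun ω =>
    ⟨pure ω, congrFun (ultrafilter_extend_extends (id : Ω → Ω)) ω⟩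
  obtain ⟨s, hs, hcomp⟩ :=
    CompactT2.ExtremallyDisconnected.projective (A := Ω) continuous_id hg hsurj
  refine ⟨s, hs, fun ω => ?_⟩
  have h := ultrafilter_extend_eq_iff.1 (congrFun hcomp ω)
  rwa [Ultrafilter.map_id] at h

/-- Bounded functions have limits along ultrafilters, and these depend continuously on the
ultrafilter. -/
theorem exists_continuousMap_tendsto {Ω : Type u} [TopologicalSpace Ω] {s : Ω → Ultrafilter Ω}
    (hs : Continuous s) {h : Ω → ℂ} {c : ℝ} (hb : ∀ η, ‖h η‖ ≤ c) :
    ∃ g : C(Ω, ℂ), ∀ ω, Tendsto h (s ω) (𝓝 (g ω)) := by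
  let h' : Ω → Metric.closedBall (0 : ℂ) c := fun η => ⟨h η, by simpa using hb η⟩
  have : CompactSpace (Metric.closedBall (0 : ℂ) c) :=
    isCompact_iff_compactSpace.1 (isCompact_closedBall 0 c)
  refine ⟨⟨fun ω => (Ultrafilter.extend h' (s ω)).1,
    continuous_subtype_val.comp ((continuous_ultrafilter_extend h').comp hs)⟩, fun ω => ?_⟩
  have h1 : Tendsto h' (s ω) (𝓝 (Ultrafilter.extend h' (s ω))) :=
    ultrafilter_extend_eq_iff.1 rfl
  exact (continuous_subtype_val.tendsto _).comp h1

section Kappa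

variable {Ω : Type u} [TopologicalSpace Ω] [CompactSpace Ω]
variable {X : Type v} [NormedAddCommGroup X] [NormedSpace ℂ X] [Module C(Ω, ℂ) X]

theorem norm_apply_le_essNorm [IsBoundedSMul C(Ω, ℂ) X] (T : RegDual Ω X) (x : X) :
    ‖T.1 x‖ ≤ ‖T‖ * essNorm Ω X x := by
  -- Scaling by `‖T‖ + ε` rather than `‖T‖` avoids dividing by zero.
  suffices h : ∀ ε > 0, ‖T.1 x‖ ≤ (‖T‖ + ε) * essNorm Ω X x by
    have hlim : Tendsto (fun ε => (‖T‖ + ε) * essNorm Ω X x) (𝓝[>] 0)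
        (𝓝 ((‖T‖ + 0) * essNorm Ω X x)) :=
      ((continuous_const.add continuous_id).mul continuous_const).continuousWithinAt
    rw [add_zero] at hlim
    exact ge_of_tendsto hlim (eventually_mem_nhdsWithin.mono fun ε hε => h ε hε)
  intro ε hε
  have hpos : 0 < ‖T‖ + ε := add_pos_of_nonneg_of_pos (norm_nonneg T) hε
  refine (ContinuousMap.norm_le _ (mul_nonneg hpos.le (essNorm_nonneg Ω x))).2 fun ω => ?_
  have hfib : ∀ η, (‖T‖ + ε)⁻¹ * ‖T.1 x η‖ ≤ fibreNorm Ω X x η := fun η => by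
    let φ : X →+ ℂ :=
      { toFun := fun y => ((‖T‖ + ε)⁻¹ : ℝ) • T.1 y η
        map_zero' := by simp
        map_add' := fun y z => by simp }
    have hv : ∀ y, ‖φ y‖ = (‖T‖ + ε)⁻¹ * ‖T.1 y η‖ := fun y => by
      change ‖((‖T‖ + ε)⁻¹ : ℝ) • T.1 y η‖ = _
      rw [norm_smul, Real.norm_of_nonneg (inv_nonneg.2 hpos.le)]
    rw [← hv]
    refine norm_apply_le_fibreNorm φ (fun y => ?_) (fun f y => ?_) x
    · rw [hv, inv_mul_le_iff₀ hpos]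
      refine ((T.1 y).norm_coe_le_norm η).trans ((T.1.le_opNorm y).trans ?_)
      exact mul_le_mul_of_nonneg_right (le_add_of_nonneg_right hε.le) (norm_nonneg y)
    · change ((‖T‖ + ε)⁻¹ : ℝ) • T.1 (f • y) η = f η • ((‖T‖ + ε)⁻¹ : ℝ) • T.1 y η
      rw [T.2 f y, ContinuousMap.mul_apply, ← smul_eq_mul, smul_comm]
  have h := le_essNorm_of_continuous (by fun_prop) hfib ω
  rwa [inv_mul_le_iff₀ hpos] at h

variable [IsScalarTower ℂ C(Ω, ℂ) X]

theorem const_smul_eq_smul (c : ℂ) (x : X) : ContinuousMap.const Ω c • x = c • x := by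
  rw [← one_smul C(Ω, ℂ) x, ← smul_assoc c (1 : C(Ω, ℂ)) x, one_smul]
  congr 1
  ext
  simp

variable [IsBoundedSMul C(Ω, ℂ) X]

/-- Contractive functionals on the fibres, taken to their limits along ultrafilters `s ω → ω` that
depend continuously on `ω`, give a contractive module map into `C(Ω)`. -/
theorem exists_regDual_tendsto {s : Ω → Ultrafilter Ω} (hs : Continuous s)
    (hlim : ∀ ω, (s ω : Filter Ω) ≤ 𝓝 ω) (φ : ∀ η, StrongDual ℂ (X ⧸ fibreKer Ω X η))
    (hφ : ∀ η, ‖φ η‖ ≤ 1) :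
    ∃ T : RegDual Ω X, ‖T‖ ≤ 1 ∧ ∀ (y : X) (ω : Ω),
      Tendsto (fun η => φ η (Submodule.Quotient.mk y)) (s ω) (𝓝 (T.1 y ω)) := by
  have hbound : ∀ (y : X) (η : Ω), ‖φ η (Submodule.Quotient.mk y)‖ ≤ ‖y‖ := fun y η =>
    (((φ η).le_of_opNorm_le (hφ η) _).trans_eq (one_mul _)).trans (fibreNorm_le Ω y η)
  choose t ht using fun y : X => exists_continuousMap_tendsto hs (hbound y)
  have hsmul : ∀ (f : C(Ω, ℂ)) (y : X), t (f • y) = f * t y := fun f y => by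
    ext ω
    refine tendsto_nhds_unique (ht (f • y) ω) ?_
    have hq : ∀ η, φ η (Submodule.Quotient.mk (f • y)) = f η * φ η (Submodule.Quotient.mk y) := by
      intro η
      rw [← smul_eq_mul, ← map_smul, ← Submodule.Quotient.mk_smul]
      refine congrArg (φ η) ((Submodule.Quotient.eq _).2 ?_)
      rw [← const_smul_eq_smul (Ω := Ω), ← sub_smul]
      exact smul_mem_fibreKer (by simp) y
    simp only [hq]
    exact ((f.continuous.tendsto ω).mono_left (hlim ω)).mul (ht y ω)
  let L : X →ₗ[ℂ] C(Ω, ℂ) :=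
    { toFun := t
      map_add' := fun y z => by
        ext ω
        refine tendsto_nhds_unique (ht (y + z) ω) ?_
        simpa using (ht y ω).add (ht z ω)
      map_smul' := fun c y => by
        rw [← const_smul_eq_smul (Ω := Ω), hsmul]
        ext
        simp }
  have hL : ∀ y, ‖L y‖ ≤ 1 * ‖y‖ := fun y => by
    rw [one_mul]
    exact (ContinuousMap.norm_le _ (norm_nonneg y)).2 fun ω =>
      le_of_tendsto (ht y ω).norm (Eventually.of_forall (hbound y))
  exact ⟨⟨L.mkContinuous 1 hL, hsmul⟩, L.mkContinuous_norm_le zero_le_one hL, ht⟩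

/-! ### The norm of the bidual map -/

/-- The seminorm which `κ` induces on `X` is the essential seminorm. -/
theorem norm_kappa_eq_essNorm [T2Space Ω] [ExtremallyDisconnected Ω] (x : X) :
    ‖kappa Ω X x‖ = essNorm Ω X x := by
  refine le_antisymm ?_ ?_
  · refine ContinuousLinearMap.opNorm_le_bound _ (essNorm_nonneg Ω x) fun T => ?_
    rw [mul_comm]
    exact norm_apply_le_essNorm T x
  · obtain ⟨s, hs, hlim⟩ := exists_continuous_ultrafilter_le_nhds Ω
    choose φ hφ hφx using fun η => exists_dual_vector'' ℂ
      (Submodule.Quotient.mk x : X ⧸ fibreKer Ω X η)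
    obtain ⟨T, hT, hTlim⟩ := exists_regDual_tendsto hs hlim φ hφ
    have hle : ‖T.1 x‖ ≤ ‖kappa Ω X x‖ :=
      ((kappa Ω X x).1.le_opNorm T).trans
        (mul_le_of_le_one_right (norm_nonneg (kappa Ω X x)) hT)
    refine le_of_forall_gt_imp_ge_of_dense fun c hc => ?_
    refine essNorm_le_of_dense ((norm_nonneg _).trans hc.le) ?_
    by_contra hd
    obtain ⟨ω, hω⟩ : ∃ ω, ω ∉ closure {ω | fibreNorm Ω X x ω < c} := not_forall.1 hd
    have hlarge : ∀ᶠ η in (s ω : Filter Ω), c ≤ ‖φ η (Submodule.Quotient.mk x)‖ := by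
      filter_upwards [hlim ω (isClosed_closure.isOpen_compl.mem_nhds hω)] with η hη
      have h : ‖φ η (Submodule.Quotient.mk x)‖ = fibreNorm Ω X x η := by
        rw [hφx]
        exact RCLike.norm_of_nonneg (norm_nonneg _)
      rw [h]
      exact not_lt.1 fun hlt => hη (subset_closure hlt)
    have := ge_of_tendsto (hTlim x ω).norm hlarge
    linarith [(T.1 x).norm_coe_le_norm ω]

end Kappa

/-! ### Identification of the completions -/

section Completion

variable (Ω : Type u) [TopologicalSpace Ω] [CompactSpace Ω]
variable (X : Type v) [NormedAddCommGroup X] [NormedSpace ℂ X] [Module C(Ω, ℂ) X]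

instance RegDual.completeSpace : CompleteSpace (RegDual Ω X) := by
  have h : IsClosed (moduleMaps Ω X : Set (X →L[ℂ] C(Ω, ℂ))) := by
    have : (moduleMaps Ω X : Set (X →L[ℂ] C(Ω, ℂ))) =
        ⋂ (f : C(Ω, ℂ)) (x : X), {T | T (f • x) = f * T x} := by
      ext T
      simp [moduleMaps]
    rw [this]
    exact isClosed_iInter fun f => isClosed_iInter fun x =>
      isClosed_eq (by fun_prop) (by fun_prop)
  exact h.completeSpace_coe

instance regularization.completeSpace : CompleteSpace (regularization Ω X) :=
  (Submodule.isClosed_topologicalClosure (LinearMap.range (kappa Ω X))).completeSpace_coe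

theorem denseRange_toRegularization : DenseRange (toRegularization Ω X) := by
  intro y
  rw [closure_subtype]
  refine closure_mono ?_ y.2
  rintro _ ⟨x, rfl⟩
  exact ⟨toRegularization Ω X x, mem_range_self x, rfl⟩

variable [IsScalarTower ℂ C(Ω, ℂ) X] [IsBoundedSMul C(Ω, ℂ) X]
variable [T2Space Ω] [ExtremallyDisconnected Ω]

theorem exists_regularization_linearIsometryEquiv :
    ∃ e : regularization Ω X ≃ₗᵢ[C(Ω, ℂ)] EssCompletion Ω X,
      ∀ x : X, e (toRegularization Ω X x) = toEssCompletion Ω x := by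
  let k : EssPre Ω X →+ regularization Ω X :=
    { toFun := fun x => toRegularization Ω X x
      map_zero' := Subtype.ext (map_zero (kappa Ω X))
      map_add' := fun x y => Subtype.ext (map_add (kappa Ω X) x y) }
  have hk : Isometry k := AddMonoidHomClass.isometry_of_norm k fun x =>
    norm_kappa_eq_essNorm (Ω := Ω) (X := X) x
  let K := k.extension hk.continuous
  have hK : Isometry K := hk.completion_extension
  have hcoe : ∀ x : X, K (toEssCompletion Ω x) = toRegularization Ω X x :=
    fun x => k.extension_coe hk.continuous x
  let F : EssCompletion Ω X →ₗᵢ[C(Ω, ℂ)] regularization Ω X :=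
    { toFun := K
      map_add' := map_add K
      map_smul' := fun f a => by
        induction a using UniformSpace.Completion.induction_on with
        | hp =>
          exact isClosed_eq (hK.continuous.comp (continuous_const_smul f))
            (hK.continuous.const_smul f)
        | ih x =>
          rw [RingHom.id_apply, ← UniformSpace.Completion.coe_smul]
          refine (hcoe (f • (show X from x))).trans ?_
          refine Eq.trans ?_ (congrArg (f • ·) (hcoe x)).symm
          exact Subtype.ext (map_smul (kappa Ω X) f x)
      norm_map' := fun a => (AddMonoidHomClass.isometry_iff_norm K).1 hK a }
  have hsurj : Function.Surjective F := by
    have hclosed : IsClosed (range F) := F.isometry.isClosedEmbedding.isClosed_range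
    have hdense : DenseRange F := (denseRange_toRegularization Ω X).mono (by
      rintro _ ⟨x, rfl⟩
      exact ⟨toEssCompletion Ω x, hcoe x⟩)
    exact range_eq_univ.1 (hclosed.closure_eq.symm.trans hdense.closure_range)
  let e := LinearIsometryEquiv.ofSurjective F hsurj
  exact ⟨e.symm, fun x => e.symm_apply_eq.2 (hcoe x).symm⟩

variable {Ω X}

theorem isRegularModule_of_norm_le_essNorm (h : ∀ x : X, ‖x‖ ≤ essNorm Ω X x) :
    IsRegularModule Ω X :=
  AddMonoidHomClass.isometry_of_norm (kappa Ω X) fun x =>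
    (norm_kappa_eq_essNorm x).trans (le_antisymm (essNorm_le_norm x) (h x))

end Completion

/-! ### Continuous sections of bundles with continuous norm -/

theorem BanachBundle.IsFell.norm_le_essNorm {Ω : Type u} [TopologicalSpace Ω] [CompactSpace Ω]
    {X : Type v} [NormedAddCommGroup X] [Module C(Ω, ℂ) X] [IsBoundedSMul C(Ω, ℂ) X]
    {B : BanachBundle.{u, w} Ω} (hB : B.IsFell) (Φ : X ≃ₗᵢ[C(Ω, ℂ)] B.sections) (x : X) :
    ‖x‖ ≤ essNorm Ω X x := by
  rw [← Φ.norm_map x, BanachBundle.norm_section_def]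
  refine Real.iSup_le (fun ω => ?_) (essNorm_nonneg Ω x)
  refine le_essNorm_of_continuous (h := fun η => ‖(Φ x).1 η‖) (hB.comp (Φ x).2) (fun η => ?_) ω
  let φ : X →+ B.Fibre η :=
    { toFun := fun y => (Φ y).1 η
      map_zero' := by simp
      map_add' := fun y z => by simp }
  refine norm_apply_le_fibreNorm φ (fun y => ?_) (fun f y => ?_) x
  · rw [← Φ.norm_map y, BanachBundle.norm_section_def]
    exact le_ciSup (BanachBundle.bddAbove_norm_section (Φ y)) η
  · change (Φ (f • y)).1 η = f η • (Φ y).1 η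
    rw [Φ.map_smul, BanachBundle.smul_section_apply]

theorem mainTheorem4
    (Ω : Type u) [TopologicalSpace Ω] [CompactSpace Ω] [T2Space Ω] [ExtremallyDisconnected Ω]
    (X : Type v) [NormedAddCommGroup X] [NormedSpace ℂ X] [CompleteSpace X]
    [Module C(Ω, ℂ) X] [IsScalarTower ℂ C(Ω, ℂ) X] [IsBoundedSMul C(Ω, ℂ) X]
    (hX : IsCConvex Ω X) :
    (∃ e : regularization Ω X ≃ₗᵢ[C(Ω, ℂ)] EssCompletion Ω X,
      ∀ x : X, e (toRegularization Ω X x) = toEssCompletion Ω x) ∧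
    (∀ B : BanachBundle.{u, w} Ω, B.IsFell →
      Nonempty (X ≃ₗᵢ[C(Ω, ℂ)] B.sections) → IsRegularModule Ω X) :=
  ⟨exists_regularization_linearIsometryEquiv Ω X, fun _ hB ⟨Φ⟩ =>
    isRegularModule_of_norm_le_essNorm (hB.norm_le_essNorm Φ)⟩
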